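/- Let $d\in\mathbb N$, $\lambda>0$, and let $V:[0,1]^d\to\mathbb R$ be $\lambda$-convex (i.e. $V-\frac\lambda2|\cdot|^2$ is convex; for $C^2$ potentials, $\nabla^2V\ge\lambda$) and separable, $V(x)=V^{[1]}(x_1)+\dots+V^{[d]}(x_d)$ with $V^{[k]}:[0,1]\to\mathbb R$. For an integer $N\ge1$ put $h=1/N$, $J^h=\{1,\dots,N\}^d$, and write $\mathbf i\sim\mathbf j$ if $\mathbf i,\mathbf j\in J^h$ satisfy $|\mathbf i-\mathbf j|=1$. Let $V^{[k],h}_j=\frac1h\int_{h(j-1)}^{hj}V^{[k]}(r)\,dr$, $\Pi^{[k],h}_j=e^{-V^{[k],h}_j}/Z^{[k],h}$ with $Z^{[k],h}$ such that $h\sum_j\Pi^{[k],h}_j=1$, and $\Pi^h_{\mathbf j}=\prod_k\Pi^{[k],h}_{j_k}$. Let $\mathcal P_+(J^h)$ be the set of $U\in(0,\infty)^{J^h}$ with $h^d\sum_{\mathbf j}U_{\mathbf j}=1$. Tangent and cotangent vectors are identified with elements of $\mathbb R^{J^h}$ of vanishing mean, paired by $P[\Xi]=h^d\sum_{\mathbf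 j}P_{\mathbf j}\Xi_{\mathbf j}$. Let $$\mathcal H^h(U)=h^d\sum_{\mathbf j\in J^h}U_{\mathbf j}\log\frac{U_{\mathbf j}}{\Pi^h_{\mathbf j}},$$ and let the Onsager operator $\mathbf K^h_U$ be given by $$P[\mathbf K^h_UQ]=h^d\sum_{\mathbf i\sim\mathbf j}\sqrt{\Pi^h_{\mathbf i}\Pi^h_{\mathbf j}}\;\Lambda\Big(\frac{U_{\mathbf i}}{\Pi^h_{\mathbf i}},\frac{U_{\mathbf j}}{\Pi^h_{\mathbf j}}\Big)\frac{P_{\mathbf i}-P_{\mathbf j}}h\,\frac{Q_{\mathbf i}-Q_{\mathbf j}}h,$$ the sum running over all unordered pairs of neighbors, where $\Lambda(a,b)=\frac{a-b}{\log a-\log b}$ for $a\ne b$ and $\Lambda(a,a)=a$. Let $F(U)=-\mathbf K^h_U\mathrm D_U\mathcal H^h$ be the gradient flow vector field of $\mathcal H^h$, and for a cotangent vector $P$ let $$\mathbf M_U[P,P]=-P\big[\mathrm D_UF[\mathbf K^h_UP]\big]+\tfrac12P\big[\mathrm D_U\mathbf K^h[F(U)]P\big].$$ Then, for every $N\ge1$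 and $h=1/N$, the maps $\mathcal H^h$, $F$ and $U\mapsto\mathbf K^h_UP$ are differentiable at every $U\in\mathcal P_+(J^h)$, and the following hold. 1. The finite-volume discretization of the Fokker–Planck flow $\partial_sv=\Delta v+\nabla\cdot(v\nabla V)$ is the gradient flow of $\mathcal H^h$ with respect to $\mathbf K^h$: for all $U\in\mathcal P_+(J^h)$ one has $F(U)=\mathbb M^hU$, where $\mathbb M^h_{\mathbf i\mathbf j}=h^{-2}\sqrt{\Pi^h_{\mathbf i}/\Pi^h_{\mathbf j}}$ if $\mathbf i\sim\mathbf j$, $\mathbb M^h_{\mathbf j\mathbf j}=-h^{-2}\sum_{\mathbf i'\sim\mathbf j}\sqrt{\Pi^h_{\mathbf i'}/\Pi^h_{\mathbf j}}$, and $\mathbb M^h_{\mathbf i\mathbf j}=0$ otherwise. 2. This flow satisfies the convex decay inequality with constant $\lambda^h=\frac2{h^2}\big(1-\exp(-\frac{h^2}2\lambda)\big)$: $$\mathbf M_U[\mathrm D_U\mathcal H^h,\mathrm D_U\mathcal H^h]\ \ge\ \lambda^h\,\mathrm D_U\mathcal H^h\big[\mathbf K^h_U\mathrm D_U\mathcal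 H^h\big]\qquad\text{for all }U\in\mathcal P_+(J^h).$$ Moreover $\lambda^h=\lambda+O(h^2)$ as $h\downarrow0$. -/

import Mathlib

namespace DiscreteFP

noncomputable section

/-- The lattice `{1,…,N}^d`; the entry `a : Fin N` stands for the number `a + 1`. -/
abbrev Lattice (d N : ℕ) : Type := Fin d → Fin N

/-- The mesh size `h = 1/N`. -/
def mesh (N : ℕ) : ℝ := 1 / (N : ℝ)

/-- Two multi-indices are neighbours if their Euclidean distance is one. -/
def Nbr {d N : ℕ} (i j : Lattice d N) : Prop :=
  ∑ k, (((i k : ℕ) : ℤ) - ((j k : ℕ) : ℤ)) ^ 2 = 1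

instance {d N : ℕ} (i j : Lattice d N) : Decidable (Nbr i j) := by
  unfold Nbr; infer_instance

theorem Nbr.symm {d N : ℕ} {i j : Lattice d N} (hij : Nbr i j) : Nbr j i := by
  unfold Nbr at *
  rw [← hij]
  exact Finset.sum_congr rfl fun k _ => by ring

/-- The positive probability densities on the lattice. -/
def posDensities (d N : ℕ) : Set (Lattice d N → ℝ) :=
  {U | (∀ j, 0 < U j) ∧ mesh N ^ d * ∑ j, U j = 1}

/-- The pairing of a cotangent vector `P` with a tangent vector `Ξ`. -/
def pairing {d N : ℕ} (P Ξ : Lattice d N → ℝ) : ℝ :=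
  mesh N ^ d * ∑ j, P j * Ξ j

/-- The average of a one-dimensional potential over the `j`-th cell. -/
def cellAverage (N : ℕ) (v : ℝ → ℝ) (j : Fin N) : ℝ :=
  1 / mesh N * ∫ r in (mesh N * (j : ℕ))..(mesh N * ((j : ℕ) + 1)), v r

/-- The one-dimensional discrete steady state, normalized by `h ∑ j, Π j = 1`. -/
def steady₁ (N : ℕ) (v : ℝ → ℝ) (j : Fin N) : ℝ :=
  Real.exp (-cellAverage N v j) / (mesh N * ∑ l, Real.exp (-cellAverage N v l))

/-- The discrete steady state `Π j = Π¹ (j 1) ⋯ Πᵈ (j d)`. -/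
def steady {d : ℕ} (N : ℕ) (v : Fin d → ℝ → ℝ) (j : Lattice d N) : ℝ :=
  ∏ k, steady₁ N (v k) (j k)

/-- The logarithmic mean. -/
def logMean (a b : ℝ) : ℝ :=
  if a = b then a else (a - b) / (Real.log a - Real.log b)

/-- The bilinear form `(P, Q) ↦ P[K_U Q]`: a sum over the unordered pairs of neighbours
(the factor `1/2` corrects for each such pair occurring twice in the double sum). -/
def onsagerForm {d N : ℕ} (π U P Q : Lattice d N → ℝ) : ℝ :=
  mesh N ^ d * (1 / 2 * ∑ i, ∑ j, if Nbr i j then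
    Real.sqrt (π i * π j) * logMean (U i / π i) (U j / π j) *
      ((P i - P j) / mesh N) * ((Q i - Q j) / mesh N) else 0)

/-- The log-mean Onsager operator `Q ↦ K_U Q`. -/
def onsager {d N : ℕ} (π U Q : Lattice d N → ℝ) : Lattice d N → ℝ := fun i =>
  ∑ j, if Nbr i j then
    Real.sqrt (π i * π j) * logMean (U i / π i) (U j / π j) * ((Q i - Q j) / mesh N ^ 2) else 0

theorem logMean_comm (a b : ℝ) : logMean a b = logMean b a := by
  unfold logMean
  by_cases h : a = b
  · simp [h]
  · rw [if_neg h, if_neg (Ne.symm h), ← neg_sub b a, ← neg_sub (Real.log b), neg_div_neg_eq]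

/-- The operator `onsager` represents the bilinear form `onsagerForm`. -/
theorem pairing_onsager {d N : ℕ} (π U P Q : Lattice d N → ℝ) :
    pairing P (onsager π U Q) = onsagerForm π U P Q := by
  unfold pairing onsager onsagerForm
  congr 1
  set w : Lattice d N → Lattice d N → ℝ := fun i j => if Nbr i j then
    Real.sqrt (π i * π j) * logMean (U i / π i) (U j / π j) * ((Q i - Q j) / mesh N ^ 2) else 0
    with hw
  have hanti : ∀ i j, w j i = -w i j := by
    intro i j
    by_cases h : Nbr i j
    · simp only [hw, if_pos h, if_pos h.symm]
      rw [mul_comm (π j), logMean_comm (U j / π j)]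
      ring
    · have h' : ¬ Nbr j i := fun h' => h h'.symm
      simp only [hw, if_neg h, if_neg h', neg_zero]
  have h1 : ∑ i, P i * ∑ j, w i j = ∑ i, ∑ j, P i * w i j := by
    simp only [Finset.mul_sum]
  have h2 : ∑ i, ∑ j, P i * w i j = -∑ i, ∑ j, P j * w i j := by
    rw [Finset.sum_comm, ← Finset.sum_neg_distrib]
    refine Finset.sum_congr rfl fun i _ => ?_
    rw [← Finset.sum_neg_distrib]
    refine Finset.sum_congr rfl fun j _ => ?_
    rw [hanti i j]; ring
  have h3 : (∑ i, ∑ j, if Nbr i j then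
      Real.sqrt (π i * π j) * logMean (U i / π i) (U j / π j) *
        ((P i - P j) / mesh N) * ((Q i - Q j) / mesh N) else 0)
      = (∑ i, ∑ j, P i * w i j) - ∑ i, ∑ j, P j * w i j := by
    rw [← Finset.sum_sub_distrib]
    refine Finset.sum_congr rfl fun i _ => ?_
    rw [← Finset.sum_sub_distrib]
    refine Finset.sum_congr rfl fun j _ => ?_
    by_cases h : Nbr i j
    · simp only [hw, if_pos h]; ring
    · simp only [hw, if_neg h]; ring
  rw [h3, h1]
  linarith

/-- The values of the Onsager operator are tangent vectors. -/
theorem sum_onsager {d N : ℕ} (π U Q : Lattice d N → ℝ) : ∑ i, onsager π U Q i = 0 := by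
  have h := pairing_onsager π U (fun _ => 1) Q
  rcases Nat.eq_zero_or_pos N with rfl | hN
  · rcases Nat.eq_zero_or_pos d with rfl | hd
    · simp [onsager, Nbr]
    · have : IsEmpty (Lattice d 0) := ⟨fun i => (i ⟨0, hd⟩).elim0⟩
      simp
  · have hm : mesh N ^ d ≠ 0 := by
      unfold mesh
      have : (N : ℝ) ≠ 0 := by exact_mod_cast hN.ne'
      positivity
    simpa [pairing, onsagerForm, hm] using h

/-- The discrete entropy `H(U) = h^d ∑ j, U j log (U j / Π j)`. -/
def entropy {d N : ℕ} (π U : Lattice d N → ℝ) : ℝ :=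
  mesh N ^ d * ∑ j, U j * Real.log (U j / π j)

/-- The differential `D_U Φ` of `Φ` along the probability densities, identified with a lattice
function of vanishing mean. The direction `e_i - h^d` is the tangential part of the `i`-th unit
vector, so only derivatives in tangential directions enter. -/
def differential {d N : ℕ} (Φ : (Lattice d N → ℝ) → ℝ) (U : Lattice d N → ℝ) :
    Lattice d N → ℝ := fun i =>
  lineDeriv ℝ Φ U (Pi.single i 1 - fun _ => mesh N ^ d) / mesh N ^ d

/-- `differential` is the representative of vanishing mean of the Fréchet derivative, as a
functional on the vectors of vanishing mean. -/
theorem differential_spec {d N : ℕ} (hN : 0 < N) {Φ : (Lattice d N → ℝ) → ℝ}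
    {U : Lattice d N → ℝ} (hΦ : DifferentiableAt ℝ Φ U) :
    ∑ i, differential Φ U i = 0 ∧
      ∀ Ξ : Lattice d N → ℝ, ∑ i, Ξ i = 0 → pairing (differential Φ U) Ξ = fderiv ℝ Φ U Ξ := by
  have hN' : (N : ℝ) ≠ 0 := by exact_mod_cast hN.ne'
  have hm : mesh N ^ d ≠ 0 := by unfold mesh; positivity
  have hone : (∑ i : Lattice d N, (Pi.single i (1 : ℝ) : Lattice d N → ℝ)) = fun _ => 1 := by
    ext j; simp [Finset.sum_apply, Pi.single_apply]
  constructor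
  · unfold differential
    rw [← Finset.sum_div]
    simp only [hΦ.lineDeriv_eq_fderiv]
    rw [← map_sum, Finset.sum_sub_distrib, hone]
    have : ((fun _ => 1 : Lattice d N → ℝ) - ∑ _i : Lattice d N, fun _ => mesh N ^ d) = 0 := by
      ext j
      simp [mesh, hN']
    rw [this]; simp
  · intro Ξ hΞ
    unfold pairing differential
    simp only [hΦ.lineDeriv_eq_fderiv]
    rw [Finset.mul_sum]
    have h1 : ∀ i, mesh N ^ d * (fderiv ℝ Φ U (Pi.single i 1 - fun _ => mesh N ^ d) /
        mesh N ^ d * Ξ i) = fderiv ℝ Φ U (Ξ i • (Pi.single i 1 - fun _ => mesh N ^ d)) := by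
      intro i
      rw [map_smul, smul_eq_mul]
      field_simp
    simp only [h1]
    rw [← map_sum]
    congr 1
    ext j
    simp only [Finset.sum_apply, Pi.smul_apply, Pi.sub_apply, smul_eq_mul, mul_sub,
      Finset.sum_sub_distrib, ← Finset.sum_mul, hΞ]
    simp [Pi.single_apply]

/-- The gradient flow vector field `F_Φ(U) = -K_U D_U Φ` of a potential `Φ` with respect to a
family `K` of Onsager operators. -/
def gradFlow {d N : ℕ} (K : (Lattice d N → ℝ) → (Lattice d N → ℝ) → (Lattice d N → ℝ))
    (Φ : (Lattice d N → ℝ) → ℝ) (U : Lattice d N → ℝ) : Lattice d N → ℝ :=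
  -K U (differential Φ U)

/-- The quadratic form
`M_U[P, P] = -P[D_U F_Φ [K_U P]] + 1/2 P[(D_U K [F_Φ(U)]) P]` on cotangent vectors. -/
def hessForm {d N : ℕ} (K : (Lattice d N → ℝ) → (Lattice d N → ℝ) → (Lattice d N → ℝ))
    (Φ : (Lattice d N → ℝ) → ℝ) (U P : Lattice d N → ℝ) : ℝ :=
  -pairing P (lineDeriv ℝ (gradFlow K Φ) U (K U P)) +
    1 / 2 * pairing P (lineDeriv ℝ (fun W => K W P) U (gradFlow K Φ U))

/-- The convex decay inequality with constant `c`: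
`M_U[D_U Φ, D_U Φ] ≥ c D_U Φ[K_U D_U Φ]` at every positive probability density `U`. -/
def ConvexDecay {d N : ℕ} (K : (Lattice d N → ℝ) → (Lattice d N → ℝ) → (Lattice d N → ℝ))
    (Φ : (Lattice d N → ℝ) → ℝ) (c : ℝ) : Prop :=
  ∀ U ∈ posDensities d N,
    c * pairing (differential Φ U) (K U (differential Φ U)) ≤ hessForm K Φ U (differential Φ U)

/-- The matrix of the finite-volume discretization of the Fokker–Planck operator. -/
def fokkerPlanck {d N : ℕ} (π : Lattice d N → ℝ) : Matrix (Lattice d N) (Lattice d N) ℝ :=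
  fun i j =>
    if Nbr i j then Real.sqrt (π i / π j) / mesh N ^ 2
    else if i = j then -((∑ l, if Nbr l j then Real.sqrt (π l / π j) else 0) / mesh N ^ 2)
    else 0

/-- The constant `λ^h = (2 / h²) (1 - exp (-h² λ / 2))`. -/
def discreteRate (lam h : ℝ) : ℝ := 2 / h ^ 2 * (1 - Real.exp (-(h ^ 2 * lam / 2)))

/-- The unit cube `[0,1]^d`. -/
def unitCube (d : ℕ) : Set (EuclideanSpace ℝ (Fin d)) := {x | ∀ k, x k ∈ Set.Icc (0 : ℝ) 1}

end

end DiscreteFP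

namespace DiscreteFP

noncomputable section

/-! In terms of the relative density ρ = U/Π the scheme is a reversible Markov chain with symmetric
edge weights w. As Λ(a,b)(log a − log b) = a − b, the logarithmic mean cancels the logarithms in K
DH (`gradFlow_entropy`). With θ(x,y) = (x−y)(log x − log y), i.e. `logGap`, the dissipation DH[K DH]
is I = ½ h^d Σ w θ(ρ_i, ρ_j) over ordered pairs, and M[DH, DH] is −½ dI/ds along the flow
(`hessForm_entropy`). The claim thus reads dI/ds ≤ −2λ^h I.

On a path this follows by coupling (`birthDeath_decay`). The two ends of an edge jump together, up
or down, at the smaller of their rates; by joint convexity of θ (`logGapDeriv_le`) these moves cost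
at most differences of θ, which telescope by reversibility. The excess rates merge the two ends.
Strong convexity of the potential makes the excess at least the fraction ε = 1 − exp(−h²λ/2) of the
rates, and opposite rates have product κ² with κ = 1/h², so merging gains 4κε = 2λ^h
(`logGapDeriv_merge_le`).

Separability makes the chain on the lattice a product of paths. Jumps in one coordinate act equally
on both ends of an edge in another, so by convexity and stationarity they do not increase I; only
the one-dimensional estimates remain (`production_decay_product`). -/

/-! ### Inequalities for a single edge -/

/-- The edge contribution `(x - y) (log x - log y)` to the entropy production. -/
def logGap (x y : ℝ) : ℝ := (x - y) * (Real.log x - Real.log y)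

/-- The derivative of `logGap` at `(x, y)` in the direction `(u, w)`. -/
def logGapDeriv (x y u w : ℝ) : ℝ :=
  (Real.log x - Real.log y) * (u - w) + (x - y) * (u / x - w / y)

theorem logGap_comm (x y : ℝ) : logGap x y = logGap y x := by
  unfold logGap; ring

theorem logGapDeriv_comm (x y u w : ℝ) : logGapDeriv x y u w = logGapDeriv y x w u := by
  unfold logGapDeriv; ring

theorem logGapDeriv_sum {ι : Type*} (s : Finset ι) (x y : ℝ) (c u w : ι → ℝ) :
    logGapDeriv x y (∑ l ∈ s, c l * u l) (∑ l ∈ s, c l * w l) =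
      ∑ l ∈ s, c l * logGapDeriv x y (u l) (w l) := by
  unfold logGapDeriv
  rw [← Finset.sum_sub_distrib, Finset.sum_div, Finset.sum_div, ← Finset.sum_sub_distrib,
    Finset.mul_sum, Finset.mul_sum, ← Finset.sum_add_distrib]
  exact Finset.sum_congr rfl fun l _ => by ring

theorem logGap_nonneg {x y : ℝ} (hx : 0 < x) (hy : 0 < y) : 0 ≤ logGap x y := by
  unfold logGap
  rcases le_total x y with h | h
  · exact mul_nonneg_of_nonpos_of_nonpos (by linarith)
      (by linarith [Real.log_le_log hx h])
  · exact mul_nonneg (by linarith) (by linarith [Real.log_le_log hy h])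

/-- Joint convexity of `logGap`. -/
theorem logGapDeriv_le {x y x' y' : ℝ} (hx : 0 < x) (hy : 0 < y) (hx' : 0 < x') (hy' : 0 < y') :
    logGapDeriv x y (x' - x) (y' - y) ≤ logGap x' y' - logGap x y := by
  -- The gap in the tangent inequality is a combination, with weights x' and y', of two instances of
  -- log z ≤ z − 1 at reciprocal arguments.
  have key : ∀ z : ℝ, 0 < z → Real.log z ≤ z - 1 := fun z hz => Real.log_le_sub_one_of_pos hz
  set A := (Real.log x' - Real.log x) - (Real.log y' - Real.log y) with hA
  have h1 : A ≤ x' * y / (x * y') - 1 := by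
    have := key (x' * y / (x * y')) (by positivity)
    rw [Real.log_div (by positivity) (by positivity), Real.log_mul hx'.ne' hy.ne',
      Real.log_mul hx.ne' hy'.ne'] at this
    rw [hA]; linarith
  have h2 : -A ≤ x * y' / (x' * y) - 1 := by
    have := key (x * y' / (x' * y)) (by positivity)
    rw [Real.log_div (by positivity) (by positivity), Real.log_mul hx'.ne' hy.ne',
      Real.log_mul hx.ne' hy'.ne'] at this
    rw [hA]; linarith
  have h3 := mul_le_mul_of_nonneg_left h1 hy'.le
  have h4 := mul_le_mul_of_nonneg_left h2 hx'.le
  have e3 : y' * (x' * y / (x * y') - 1) = x' * y / x - y' := by field_simp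
  have e4 : x' * (x * y' / (x' * y) - 1) = y' * x / y - x' := by field_simp
  rw [e3] at h3
  rw [e4] at h4
  have e5 : logGap x' y' - logGap x y - logGapDeriv x y (x' - x) (y' - y)
      = (x' - y') * A + x' * y / x - y' + (y' * x / y - x') := by
    unfold logGap logGapDeriv
    rw [hA]
    field_simp
    ring
  nlinarith

/-- The geometric mean is at most the logarithmic mean; with t half the log-ratio this is t ≤ sinh
t. -/
theorem logGap_sq_le {x y : ℝ} (hx : 0 < x) (hy : 0 < y) :
    logGap x y * Real.sqrt (x * y) ≤ (x - y) ^ 2 := by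
  wlog h : y ≤ x generalizing x y
  · have := this hy hx (le_of_not_ge h)
    rw [logGap_comm, mul_comm y x] at this
    nlinarith
  have hs : 0 < Real.sqrt (x * y) := Real.sqrt_pos.2 (by positivity)
  have hlog : Real.log y ≤ Real.log x := Real.log_le_log hy h
  set t := (Real.log x - Real.log y) / 2 with ht
  have hsinh : t ≤ Real.sinh t := Real.self_le_sinh_iff.2 (by rw [ht]; linarith)
  have hsq : Real.sqrt (x * y) = Real.exp ((Real.log x + Real.log y) / 2) := by
    rw [← Real.log_mul hx.ne' hy.ne', Real.exp_half, Real.exp_log (by positivity)]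
  have e1 : Real.sqrt (x * y) * Real.exp t = x := by
    rw [hsq, ← Real.exp_add, ht]
    conv_rhs => rw [← Real.exp_log hx]
    congr 1; ring
  have e2 : Real.sqrt (x * y) * Real.exp (-t) = y := by
    rw [hsq, ← Real.exp_add, ht]
    conv_rhs => rw [← Real.exp_log hy]
    congr 1; ring
  have h3 : Real.sqrt (x * y) * (Real.log x - Real.log y) ≤ x - y := by
    have := mul_le_mul_of_nonneg_left hsinh hs.le
    rw [Real.sinh_eq] at this
    have e : Real.sqrt (x * y) * ((Real.exp t - Real.exp (-t)) / 2) = (x - y) / 2 := by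
      rw [mul_div_assoc', mul_sub, e1, e2]
    rw [e, ht] at this
    linarith
  unfold logGap
  nlinarith

/-- The decay caused by merging the two ends of an edge, at rates `p` and `q` bounded below by
`ε a` and `ε b`. -/
theorem logGapDeriv_merge_le {x y p q a b ε κ : ℝ} (hx : 0 < x) (hy : 0 < y) (ha : 0 < a)
    (hb : 0 < b) (hε : 0 ≤ ε) (hκ : 0 ≤ κ) (hab : a * b = κ ^ 2) (hp : ε * a ≤ p)
    (hq : ε * b ≤ q) :
    p * logGapDeriv x y (y - x) 0 + q * logGapDeriv x y 0 (x - y) ≤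
      -(4 * κ * ε) * logGap x y := by
  have hθ := logGap_nonneg hx hy
  have hsqle := logGap_sq_le hx hy
  have hs : 0 < Real.sqrt (x * y) := Real.sqrt_pos.2 (by positivity)
  have hss : Real.sqrt (x * y) ^ 2 = x * y := Real.sq_sqrt (by positivity)
  set s := Real.sqrt (x * y) with hs_def
  -- Each of the two terms yields half of the constant: p + q ≥ 2κε by AM–GM, and p/x + q/y ≥
  -- 2κε/√(xy), which `logGap_sq_le` pairs with (x − y)².
  have e : p * logGapDeriv x y (y - x) 0 + q * logGapDeriv x y 0 (x - y)
      = -(p + q) * logGap x y - (p / x + q / y) * (x - y) ^ 2 := by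
    unfold logGapDeriv logGap
    field_simp
    ring
  have h1 : 2 * κ ≤ a + b := by
    refine (pow_le_pow_iff_left₀ (by positivity) (by positivity) two_ne_zero).1 ?_
    nlinarith [sq_nonneg (a - b)]
  have h2 : 2 * κ ≤ s * (a / x + b / y) := by
    refine (pow_le_pow_iff_left₀ (by positivity) (by positivity) two_ne_zero).1 ?_
    have : (s * (a / x + b / y)) ^ 2 = (a / x + b / y) ^ 2 * (x * y) := by
      rw [← hss]; ring
    have e2 : (a / x + b / y) ^ 2 * (x * y) = (a / x - b / y) ^ 2 * (x * y) + 4 * (a * b) := by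
      field_simp
      ring
    rw [this, e2, hab]
    have : 0 ≤ (a / x - b / y) ^ 2 * (x * y) := by positivity
    linarith
  have h3 : ε * (a / x + b / y) ≤ p / x + q / y := by
    have := div_le_div_of_nonneg_right hp hx.le
    have := div_le_div_of_nonneg_right hq hy.le
    have : ε * (a / x + b / y) = ε * a / x + ε * b / y := by ring
    linarith
  have h4 : 2 * κ * ε * logGap x y ≤ (p + q) * logGap x y :=
    mul_le_mul_of_nonneg_right (by nlinarith) hθ
  have h5 : 2 * κ * ε * logGap x y ≤ (p / x + q / y) * (x - y) ^ 2 := by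
    have h6 : ε * (a / x + b / y) * (x - y) ^ 2 ≤ (p / x + q / y) * (x - y) ^ 2 :=
      mul_le_mul_of_nonneg_right h3 (sq_nonneg _)
    have h7 : ε * (a / x + b / y) * (logGap x y * s) ≤ ε * (a / x + b / y) * (x - y) ^ 2 :=
      mul_le_mul_of_nonneg_left hsqle (by positivity)
    have h8 : 2 * κ * (ε * logGap x y) ≤ s * (a / x + b / y) * (ε * logGap x y) :=
      mul_le_mul_of_nonneg_right h2 (by positivity)
    nlinarith
  rw [e]
  nlinarith

/-! ### Coupling for birth-death chains -/

/-- Decay of the entropy production of a birth-death chain on `{0, …, M}` with birth rates `A`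
and death rates `B`, reversible with respect to `μ`. -/
theorem birthDeath_decay {M : ℕ} {A B μ φ : ℕ → ℝ} {ε κ : ℝ} (hφ : ∀ j, 0 < φ j)
    (hμ : ∀ j, 0 ≤ μ j) (hA : ∀ j, 0 ≤ A j) (hB : ∀ j, 0 ≤ B j) (hAM : A M = 0) (hB0 : B 0 = 0)
    (hrev : ∀ j < M, μ j * A j = μ (j + 1) * B (j + 1)) (hε : 0 ≤ ε) (hκ : 0 < κ)
    (hAB : ∀ j < M, A j * B (j + 1) = κ ^ 2)
    (hAε : ∀ j < M, ε * A j ≤ A j - A (j + 1))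
    (hBε : ∀ j < M, ε * B (j + 1) ≤ B (j + 1) - B j) :
    ∑ j ∈ Finset.range M, μ j * A j * logGapDeriv (φ j) (φ (j + 1))
        (A j * (φ (j + 1) - φ j) + B j * (φ (j - 1) - φ j))
        (A (j + 1) * (φ (j + 2) - φ (j + 1)) + B (j + 1) * (φ j - φ (j + 1)))
      ≤ -(4 * κ * ε) * ∑ j ∈ Finset.range M, μ j * A j * logGap (φ j) (φ (j + 1)) := by
  -- `S` is the flux of θ between consecutive edges. It vanishes at both ends because `B 0 = 0` and
  -- `A M = 0`; these also make the truncated index `0 - 1` and the value at `M + 1` harmless.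
  set S : ℕ → ℝ := fun j =>
    μ j * A j * B j * (logGap (φ j) (φ (j + 1)) - logGap (φ (j - 1)) (φ j)) with hS
  have hS0 : ∑ j ∈ Finset.range M, (S (j + 1) - S j) = 0 := by
    rw [Finset.sum_range_sub]
    simp [hS, hAM, hB0]
  rw [Finset.mul_sum, ← add_zero (∑ j ∈ Finset.range M, -(4 * κ * ε) * _), ← hS0,
    ← Finset.sum_add_distrib]
  refine Finset.sum_le_sum fun j hj => ?_
  have hj := Finset.mem_range.1 hj
  have hpos : 0 < A j ∧ 0 < B (j + 1) := by
    have h := hAB j hj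
    have : 0 < A j * B (j + 1) := by rw [h]; positivity
    exact ⟨pos_of_mul_pos_left this (hB _), pos_of_mul_pos_right this (hA _)⟩
  have hup := logGapDeriv_le (hφ j) (hφ (j + 1)) (hφ (j + 1)) (hφ (j + 2))
  have hmerge := logGapDeriv_merge_le (hφ j) (hφ (j + 1)) hpos.1 hpos.2 hε hκ.le (hAB j hj)
    (hAε j hj) (hBε j hj)
  have hdown : B j * logGapDeriv (φ j) (φ (j + 1)) (φ (j - 1) - φ j) (φ j - φ (j + 1)) ≤
      B j * (logGap (φ (j - 1)) (φ j) - logGap (φ j) (φ (j + 1))) :=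
    mul_le_mul_of_nonneg_left (logGapDeriv_le (hφ j) (hφ (j + 1)) (hφ (j - 1)) (hφ j)) (hB j)
  have hup' := mul_le_mul_of_nonneg_left hup (hA (j + 1))
  -- The coupling: the edge moves up as a whole at rate `A (j + 1)` and down at rate `B j`; what is
  -- left of each rate moves one end onto the other.
  have hsplit : logGapDeriv (φ j) (φ (j + 1))
        (A j * (φ (j + 1) - φ j) + B j * (φ (j - 1) - φ j))
        (A (j + 1) * (φ (j + 2) - φ (j + 1)) + B (j + 1) * (φ j - φ (j + 1)))
      = A (j + 1) * logGapDeriv (φ j) (φ (j + 1)) (φ (j + 1) - φ j) (φ (j + 2) - φ (j + 1))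
        + B j * logGapDeriv (φ j) (φ (j + 1)) (φ (j - 1) - φ j) (φ j - φ (j + 1))
        + ((A j - A (j + 1)) * logGapDeriv (φ j) (φ (j + 1)) (φ (j + 1) - φ j) 0
          + (B (j + 1) - B j) * logGapDeriv (φ j) (φ (j + 1)) 0 (φ j - φ (j + 1))) := by
    unfold logGapDeriv
    ring
  have hSeq : S (j + 1) - S j = μ j * A j *
      (A (j + 1) * (logGap (φ (j + 1)) (φ (j + 2)) - logGap (φ j) (φ (j + 1)))
        + B j * (logGap (φ (j - 1)) (φ j) - logGap (φ j) (φ (j + 1)))) := by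
    simp only [hS, Nat.add_sub_cancel]
    linear_combination (-A (j + 1) * (logGap (φ (j + 1)) (φ (j + 2)) - logGap (φ j) (φ (j + 1))))
      * hrev j hj
  rw [hsplit, hSeq]
  have := mul_le_mul_of_nonneg_left (add_le_add (add_le_add hup' hdown) hmerge)
    (mul_nonneg (hμ j) (hA j))
  linarith

/-! ### Product chains -/

/-- The generator `(L f) n = ∑ m, r n m (f m - f n)` of the chain with jump rates `r`. -/
def jumpGen {ι : Type*} [Fintype ι] (r : ι → ι → ℝ) (f : ι → ℝ) (n : ι) : ℝ :=
  ∑ m, r n m * (f m - f n)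

/-- The entropy production of the chain with jump rates `r` and weights `μ` decays with rate `c`:
its derivative along the flow of `jumpGen r` is at most `-c` times the entropy production. -/
def ProductionDecay {ι : Type*} [Fintype ι] (c : ℝ) (μ : ι → ℝ) (r : ι → ι → ℝ) : Prop :=
  ∀ f : ι → ℝ, (∀ n, 0 < f n) →
    ∑ n, ∑ m, μ n * r n m * logGapDeriv (f n) (f m) (jumpGen r f n) (jumpGen r f m) ≤
      -c * ∑ n, ∑ m, μ n * r n m * logGap (f n) (f m)

-- Exchanging the old and the new value of the `k`-th coordinate is an involution. Combined with
-- reversibility it expresses stationarity.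
open Function in
theorem sum_sum_update {α ι : Type*} [Fintype α] [DecidableEq α] [Fintype ι] (k : α)
    (F : (α → ι) → ι → ℝ) :
    ∑ i : α → ι, ∑ n, F (update i k n) (i k) = ∑ i : α → ι, ∑ n, F i n := by
  rw [← Fintype.sum_prod_type', ← Fintype.sum_prod_type']
  let e : (α → ι) × ι ≃ (α → ι) × ι :=
    { toFun := fun p => (update p.1 k p.2, p.1 k)
      invFun := fun p => (update p.1 k p.2, p.1 k)
      left_inv := fun p => by simp
      right_inv := fun p => by simp }
  exact Equiv.sum_comp e fun p => F p.1 p.2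

open Function in
/-- Tensorization: the entropy production of a product chain decays if this holds along each
coordinate line. -/
theorem production_decay_product {α ι : Type*} [Fintype α] [DecidableEq α] [Fintype ι]
    [Nonempty ι] {π : (α → ι) → ℝ} {r : α → ι → ι → ℝ} {c : ℝ} (hπ : ∀ i, 0 ≤ π i)
    (hr : ∀ k n m, 0 ≤ r k n m)
    (hrev : ∀ i k m, π i * r k (i k) m = π (update i k m) * r k m (i k))
    (hline : ∀ i k, ProductionDecay c (fun n => π (update i k n)) (r k))
    {f g : (α → ι) → ℝ} (hf : ∀ i, 0 < f i)
    (hg : ∀ i, g i = ∑ l, jumpGen (r l) (fun n => f (update i l n)) (i l)) :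
    ∑ i, ∑ k, ∑ m, π i * r k (i k) m *
        logGapDeriv (f i) (f (update i k m)) (g i) (g (update i k m)) ≤
      -c * ∑ i, ∑ k, ∑ m, π i * r k (i k) m * logGap (f i) (f (update i k m)) := by
  rw [Finset.sum_comm, Finset.sum_comm (f := fun i k => ∑ m, π i * r k (i k) m *
    logGap (f i) (f (update i k m))), Finset.mul_sum]
  refine Finset.sum_le_sum fun k _ => ?_
  set G : α → (α → ι) → ℝ := fun l i => jumpGen (r l) (fun n => f (update i l n)) (i l) with hG
  have hsplit : ∀ i m, logGapDeriv (f i) (f (update i k m)) (g i) (g (update i k m)) =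
      ∑ l, logGapDeriv (f i) (f (update i k m)) (G l i) (G l (update i k m)) := by
    intro i m
    have := logGapDeriv_sum Finset.univ (f i) (f (update i k m)) (fun _ => 1)
      (fun l => G l i) (fun l => G l (update i k m))
    simp only [one_mul] at this
    rw [hg, hg, ← this]
  set T : α → ℝ := fun l => ∑ i, ∑ m, π i * r k (i k) m *
    logGapDeriv (f i) (f (update i k m)) (G l i) (G l (update i k m)) with hT
  have hsum : ∑ i, ∑ m, π i * r k (i k) m *
      logGapDeriv (f i) (f (update i k m)) (g i) (g (update i k m)) = ∑ l, T l := by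
    simp only [hT, hsplit, Finset.mul_sum]
    rw [Finset.sum_comm]
    rw [Finset.sum_comm (s := Finset.univ (α := α))]
    rw [Finset.sum_comm]
    exact Finset.sum_congr rfl fun i _ => Finset.sum_comm
  -- The hypothesis concerns whole lines. Summing it over all base points counts every line once per
  -- point on it, whence the factor `card ι`.
  have hdiag : T k ≤ -c * ∑ i, ∑ m, π i * r k (i k) m * logGap (f i) (f (update i k m)) := by
    have hcard : (0 : ℝ) < Fintype.card ι := by exact_mod_cast Fintype.card_pos
    have havg : ∀ F : (α → ι) → ℝ, (Fintype.card ι : ℝ) * ∑ i, F i =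
        ∑ i, ∑ n, F (update i k n) := by
      intro F
      rw [sum_sum_update k (fun i _ => F i)]
      simp [Finset.mul_sum]
    refine le_of_mul_le_mul_left ?_ hcard
    rw [mul_left_comm, havg, havg, Finset.mul_sum]
    refine Finset.sum_le_sum fun i _ => ?_
    have := hline i k (fun n => f (update i k n)) (fun n => hf _)
    simpa [hG] using this
  -- A jump in direction l moves both ends of a k-edge at the same rate. Convexity bounds its effect
  -- by the l-generator applied to the edge's θ, and this averages to zero.
  have hoff : ∀ l, l ≠ k → T l ≤ 0 := by
    intro l hl
    have hcoord : ∀ (i : α → ι) m, (update i k m) l = i l := fun i m => update_of_ne hl _ _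
    have hcomm : ∀ (i : α → ι) m n, update (update i k m) l n = update (update i l n) k m :=
      fun i m n => update_comm hl.symm _ _ _
    have hbound : T l ≤ ∑ i, ∑ m, ∑ n, π i * r k (i k) m * (r l (i l) n *
        (logGap (f (update i l n)) (f (update (update i l n) k m)) -
          logGap (f i) (f (update i k m)))) := by
      refine Finset.sum_le_sum fun i _ => Finset.sum_le_sum fun m _ => ?_
      rw [← Finset.mul_sum]
      refine mul_le_mul_of_nonneg_left ?_ (mul_nonneg (hπ _) (hr _ _ _))
      simp only [hG, jumpGen, hcoord, hcomm, update_eq_self]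
      have e : update i k m = update (update i l (i l)) k m := by rw [update_eq_self]
      rw [logGapDeriv_sum]
      refine Finset.sum_le_sum fun n _ => mul_le_mul_of_nonneg_left ?_ (hr _ _ _)
      have e2 : update (update i k m) l (i l) = update i k m := by
        rw [hcomm, update_eq_self]
      simpa [e2] using logGapDeriv_le (hf i) (hf (update i k m)) (hf (update i l n))
        (hf (update (update i l n) k m))
    refine hbound.trans (le_of_eq ?_)
    set F : (α → ι) → ι → ℝ := fun i n => ∑ m, π i * r k (i k) m * r l (i l) n *
      logGap (f i) (f (update i k m)) with hF
    have h1 : ∑ i, ∑ m, ∑ n, π i * r k (i k) m * (r l (i l) n *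
        (logGap (f (update i l n)) (f (update (update i l n) k m)) -
          logGap (f i) (f (update i k m)))) =
        ∑ i, ∑ n, F (update i l n) (i l) - ∑ i, ∑ n, F i n := by
      rw [← Finset.sum_sub_distrib]
      refine Finset.sum_congr rfl fun i _ => ?_
      rw [Finset.sum_comm, ← Finset.sum_sub_distrib]
      refine Finset.sum_congr rfl fun n _ => ?_
      rw [hF, ← Finset.sum_sub_distrib]
      refine Finset.sum_congr rfl fun m _ => ?_
      simp only [update_self, update_of_ne hl.symm]
      linear_combination (r k (i k) m *
        logGap (f (update i l n)) (f (update (update i l n) k m))) * hrev i l n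
    rw [h1, sum_sum_update, sub_self]
  rw [hsum]
  have := Finset.sum_le_sum (s := Finset.univ.erase k) fun l hl => hoff l (Finset.ne_of_mem_erase hl)
  rw [← Finset.add_sum_erase _ _ (Finset.mem_univ k)]
  simp only [Finset.sum_const_zero] at this
  linarith

/-! ### From the potential to its cell averages -/

/-- Restrict V to a line parallel to an axis: the other summands are constant there, and the line is
embedded isometrically. The frozen value 1/2 is arbitrary in [0,1]. -/
theorem strongConvexOn_coordinate {d : ℕ} {lam : ℝ} {V : EuclideanSpace ℝ (Fin d) → ℝ}
    {v : Fin d → ℝ → ℝ} (hV : StrongConvexOn (unitCube d) lam V)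
    (hsep : ∀ x ∈ unitCube d, V x = ∑ k, v k (x k)) (k : Fin d) :
    StrongConvexOn (Set.Icc 0 1) lam (v k) := by
  set X : ℝ → EuclideanSpace ℝ (Fin d) :=
    fun t => WithLp.toLp 2 (Function.update (fun _ => 1 / 2) k t) with hX
  have hXmem : ∀ t ∈ Set.Icc (0 : ℝ) 1, X t ∈ unitCube d := by
    intro t ht l
    by_cases h : l = k
    · subst h; simpa [hX] using ht
    · simp only [hX, Function.update_of_ne h]
      norm_num
  have hVX : ∀ t ∈ Set.Icc (0 : ℝ) 1,
      V (X t) = v k t + ∑ l ∈ Finset.univ.erase k, v l (1 / 2) := by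
    intro t ht
    rw [hsep _ (hXmem t ht), ← Finset.add_sum_erase _ _ (Finset.mem_univ k)]
    congr 1
    · simp [hX]
    · exact Finset.sum_congr rfl fun l hl => by
        simp [hX, Function.update_of_ne (Finset.ne_of_mem_erase hl)]
  refine ⟨convex_Icc 0 1, fun x hx y hy a b ha hb hab => ?_⟩
  have hmem : a • x + b • y ∈ Set.Icc (0 : ℝ) 1 := convex_Icc 0 1 hx hy ha hb hab
  have h := hV.2 (hXmem x hx) (hXmem y hy) ha hb hab
  have e1 : a • X x + b • X y = X (a • x + b • y) := by
    ext l
    by_cases hl : l = k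
    · subst hl; simp [hX]
    · simp only [hX, PiLp.add_apply, PiLp.smul_apply, Function.update_of_ne hl, ← add_smul, hab,
        one_smul]
  have e2 : X x - X y = EuclideanSpace.single k (x - y) := by
    ext l
    by_cases hl : l = k
    · subst hl; simp [hX]
    · simp [hX, hl]
  rw [e1, e2, PiLp.norm_single, hVX _ hx, hVX _ hy, hVX _ hmem] at h
  simp only [smul_eq_mul] at h ⊢
  linear_combination h + (∑ l ∈ Finset.univ.erase k, v l (1 / 2)) * hab

/-- A convex function on a compact interval is integrable, even if it jumps at the endpoints. -/
theorem ConvexOn.integrableOn_Icc {f : ℝ → ℝ} {a b : ℝ} (hf : ConvexOn ℝ (Set.Icc a b) f) :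
    MeasureTheory.IntegrableOn f (Set.Icc a b) := by
  rcases lt_or_ge b a with hab | hab
  · simp [Set.Icc_eq_empty_of_lt hab]
  rw [integrableOn_Icc_iff_integrableOn_Ioo]
  have hcont : ContinuousOn f (Set.Ioo a b) := by
    simpa using hf.continuousOn_interior
  have hupper : ∀ x ∈ Set.Icc a b, f x ≤ max (f a) (f b) := fun x hx =>
    hf.le_max_of_mem_Icc (Set.left_mem_Icc.2 hab) (Set.right_mem_Icc.2 hab) hx
  -- Convexity at the midpoint of x and its reflection a + b − x turns the upper bound into a lower
  -- one.
  have hlower : ∀ x ∈ Set.Icc a b, 2 * f ((a + b) / 2) - max (f a) (f b) ≤ f x := by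
    intro x hx
    have hx' : a + b - x ∈ Set.Icc a b := ⟨by linarith [hx.2], by linarith [hx.1]⟩
    have h1 := hf.2 hx hx' (by norm_num : (0 : ℝ) ≤ 1 / 2) (by norm_num : (0 : ℝ) ≤ 1 / 2)
      (by norm_num)
    have h2 := hupper _ hx'
    have e : (1 / 2 : ℝ) • x + (1 / 2 : ℝ) • (a + b - x) = (a + b) / 2 := by
      simp only [smul_eq_mul]; ring
    rw [e] at h1
    simp only [smul_eq_mul] at h1
    linarith
  refine MeasureTheory.IntegrableOn.of_bound (C := |2 * f ((a + b) / 2) - max (f a) (f b)| +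
    |max (f a) (f b)|) (by simp) (hcont.aestronglyMeasurable measurableSet_Ioo) ?_
  refine (MeasureTheory.ae_restrict_iff' measurableSet_Ioo).2 (Filter.Eventually.of_forall ?_)
  intro x hx
  have hx := Set.Ioo_subset_Icc_self hx
  rw [Real.norm_eq_abs, abs_le]
  have h1 := hupper x hx
  have h2 := hlower x hx
  constructor
  · linarith [neg_abs_le (2 * f ((a + b) / 2) - max (f a) (f b)), abs_nonneg (max (f a) (f b))]
  · linarith [le_abs_self (max (f a) (f b)), abs_nonneg (2 * f ((a + b) / 2) - max (f a) (f b))]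

/-- The average of `f` over the `j`-th cell of mesh size `h`. -/
def cellMean (h : ℝ) (f : ℝ → ℝ) (j : ℕ) : ℝ :=
  1 / h * ∫ r in (h * j)..(h * (j + 1)), f r

/-- Shift the outer two cells onto the middle one and integrate f(r+h) − 2f(r) + f(r−h) ≥ λh², which
is strong convexity at the midpoint of r ± h. -/
theorem cellMean_second_difference {h lam : ℝ} {f : ℝ → ℝ} (hh : 0 < h)
    (hf : StrongConvexOn (Set.Icc 0 1) lam f) (hlam : 0 ≤ lam) {j : ℕ}
    (hj : h * (j + 3) ≤ 1) :
    lam * h ^ 2 ≤ cellMean h f (j + 2) - 2 * cellMean h f (j + 1) + cellMean h f j := by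
  have hint : ∀ a b : ℝ, 0 ≤ a → a ≤ b → b ≤ 1 →
      IntervalIntegrable f MeasureTheory.volume a b := by
    intro a b ha hab hb
    have hcvx : ConvexOn ℝ (Set.Icc 0 1) f := hf.convexOn fun r => by
      simp only [Pi.zero_apply]; positivity
    refine (intervalIntegrable_iff_integrableOn_Ioc_of_le hab).2
      ((ConvexOn.integrableOn_Icc hcvx).mono_set fun x hx => ⟨by linarith [hx.1], hx.2.trans hb⟩)
  have hj0 : (0 : ℝ) ≤ h * j := by positivity
  set a : ℝ := h * (j + 1) with ha
  have ha1 : h ≤ a := by rw [ha]; nlinarith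
  have ha2 : a + 2 * h ≤ 1 := by rw [ha]; linarith
  have e0 : cellMean h f j = 1 / h * ∫ r in a..(a + h), f (r - h) := by
    rw [intervalIntegral.integral_comp_sub_right (fun r => f r), cellMean]
    congr 2 <;> rw [ha] <;> ring
  have e1 : cellMean h f (j + 1) = 1 / h * ∫ r in a..(a + h), f r := by
    rw [cellMean]; push_cast
    congr 2; rw [ha]; ring
  have e2 : cellMean h f (j + 2) = 1 / h * ∫ r in a..(a + h), f (r + h) := by
    rw [intervalIntegral.integral_comp_add_right (fun r => f r), cellMean]; push_cast
    congr 2 <;> rw [ha] <;> ring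
  have i0 : IntervalIntegrable (fun r => f (r - h)) MeasureTheory.volume a (a + h) := by
    simpa using (hint (a - h) a (by linarith) (by linarith) (by linarith)).comp_sub_right h
  have i1 := hint a (a + h) (by linarith) (by linarith) (by linarith)
  have i2 : IntervalIntegrable (fun r => f (r + h)) MeasureTheory.volume a (a + h) := by
    simpa using (hint (a + h) (a + h + h) (by linarith) (by linarith)
      (by linarith)).comp_add_right h
  have hpt : ∀ r ∈ Set.Icc a (a + h), lam * h ^ 2 ≤ f (r + h) - 2 * f r + f (r - h) := by
    intro r hr
    have hr1 : r + h ∈ Set.Icc (0 : ℝ) 1 := ⟨by linarith [hr.1], by linarith [hr.2]⟩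
    have hr2 : r - h ∈ Set.Icc (0 : ℝ) 1 := ⟨by linarith [hr.1], by linarith [hr.2]⟩
    have h1 := hf.2 hr1 hr2 (by norm_num : (0 : ℝ) ≤ 1 / 2) (by norm_num : (0 : ℝ) ≤ 1 / 2)
      (by norm_num)
    have e : (1 / 2 : ℝ) • (r + h) + (1 / 2 : ℝ) • (r - h) = r := by
      simp only [smul_eq_mul]; ring
    have e' : r + h - (r - h) = 2 * h := by ring
    rw [e, e'] at h1
    simp only [smul_eq_mul, Real.norm_eq_abs, sq_abs] at h1
    linarith
  have hI : ∫ _r in a..(a + h), lam * h ^ 2 ≤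
      ∫ r in a..(a + h), (f (r + h) - 2 * f r + f (r - h)) :=
    intervalIntegral.integral_mono_on (by linarith) intervalIntegrable_const
      ((i2.sub (i1.const_mul 2)).add i0) hpt
  rw [intervalIntegral.integral_add (i2.sub (i1.const_mul 2)) i0,
    intervalIntegral.integral_sub i2 (i1.const_mul 2), intervalIntegral.integral_const, smul_eq_mul,
    intervalIntegral.integral_const_mul] at hI
  rw [e0, e1, e2]
  have := mul_le_mul_of_nonneg_left hI (by positivity : 0 ≤ 1 / h)
  have e : 1 / h * ((a + h - a) * (lam * h ^ 2)) = lam * h ^ 2 := by field_simp; ring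
  rw [e] at this
  linarith

/-! ### Paths with a strongly convex potential -/

/-- Adjacency on the path `{0, …, N - 1}`. -/
def PathAdj {N : ℕ} (n m : Fin N) : Prop := (m : ℕ) = n + 1 ∨ (n : ℕ) = m + 1

instance {N : ℕ} (n m : Fin N) : Decidable (PathAdj n m) := by
  unfold PathAdj; infer_instance

theorem sum_pathAdj {M : ℕ} (F : ℕ → ℕ → ℝ) :
    ∑ n : Fin (M + 1), ∑ m : Fin (M + 1), (if PathAdj n m then F n m else 0) =
      ∑ j ∈ Finset.range M, (F j (j + 1) + F (j + 1) j) := by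
  have hsplit : ∀ n m : Fin (M + 1), (if PathAdj n m then F n m else 0) =
      (if (m : ℕ) = n + 1 then F n m else 0) + (if (n : ℕ) = m + 1 then F n m else 0) := by
    intro n m
    by_cases h1 : (m : ℕ) = n + 1
    · rw [if_pos (show PathAdj n m from Or.inl h1), if_pos h1, if_neg (by omega), add_zero]
    · by_cases h2 : (n : ℕ) = m + 1
      · rw [if_pos (show PathAdj n m from Or.inr h2), if_neg h1, if_pos h2, zero_add]
      · rw [if_neg (show ¬ PathAdj n m from not_or.2 ⟨h1, h2⟩), if_neg h1, if_neg h2, zero_add]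
  have hone : ∀ G : ℕ → ℕ → ℝ, ∑ n : Fin (M + 1), ∑ m : Fin (M + 1),
      (if (m : ℕ) = n + 1 then G n m else 0) = ∑ j ∈ Finset.range M, G j (j + 1) := by
    intro G
    have h1 : ∀ n : Fin (M + 1), ∑ m : Fin (M + 1), (if (m : ℕ) = n + 1 then G n m else 0) =
        if (n : ℕ) < M then G n (n + 1) else 0 := by
      intro n
      rw [Fin.sum_univ_eq_sum_range (fun m => if m = (n : ℕ) + 1 then G n m else 0),
        Finset.sum_ite_eq']
      simp
    rw [Finset.sum_congr rfl fun n _ => h1 n,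
      Fin.sum_univ_eq_sum_range (fun n => if n < M then G n (n + 1) else 0),
      Finset.sum_range_succ, if_neg (lt_irrefl M), add_zero]
    exact Finset.sum_congr rfl fun j hj => if_pos (Finset.mem_range.1 hj)
  simp only [hsplit, Finset.sum_add_distrib]
  rw [hone F, Finset.sum_comm (f := fun n m : Fin (M + 1) =>
    if (n : ℕ) = m + 1 then F n m else 0), hone fun m n => F n m]

/-- The jump rates on a path with potential `W` and mesh size `h`. -/
def pathRate {N : ℕ} (h : ℝ) (W : ℕ → ℝ) (n m : Fin N) : ℝ :=
  if PathAdj n m then Real.exp ((W n - W m) / 2) / h ^ 2 else 0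

theorem pathRate_nonneg {N : ℕ} (h : ℝ) (W : ℕ → ℝ) (n m : Fin N) : 0 ≤ pathRate h W n m := by
  unfold pathRate
  split_ifs <;> positivity

/-- Consecutive upward rates have quotient exp(−½ · second difference of W), and likewise the
downward ones, so strong convexity gives the contraction by exp(−h²λ/2). The free factor `C` admits
the unnormalized weights on a line of the lattice. -/
theorem pathRate_decay {N : ℕ} {h lam C : ℝ} {W : ℕ → ℝ} (hh : 0 < h) (hlam : 0 ≤ lam)
    (hC : 0 ≤ C) (hN : 0 < N)
    (hW : ∀ j, j + 2 < N → lam * h ^ 2 ≤ W (j + 2) - 2 * W (j + 1) + W j) :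
    ProductionDecay (2 * discreteRate lam h) (fun n : Fin N => C * Real.exp (-W n))
      (pathRate h W) := by
  obtain ⟨M, rfl⟩ : ∃ M, N = M + 1 := ⟨N - 1, by omega⟩
  intro f hf
  -- The default 1 only has to be positive: values beyond the path are multiplied by a zero rate.
  set φ : ℕ → ℝ := fun j => if hj : j < M + 1 then f ⟨j, hj⟩ else 1 with hφ_def
  have hφf : ∀ n : Fin (M + 1), f n = φ n := fun n => by
    simp only [hφ_def, dif_pos n.isLt, Fin.eta]
  have hφ : ∀ j, 0 < φ j := by
    intro j
    simp only [hφ_def]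
    split_ifs
    · exact hf _
    · exact one_pos
  set ρ : ℕ → ℕ → ℝ := fun n m => Real.exp ((W n - W m) / 2) / h ^ 2 with hρ
  have hρpos : ∀ n m, 0 < ρ n m := fun n m => by simp only [hρ]; positivity
  set μ : ℕ → ℝ := fun n => C * Real.exp (-W n) with hμ
  set A : ℕ → ℝ := fun j => if j < M then ρ j (j + 1) else 0 with hA
  set B : ℕ → ℝ := fun j => if 0 < j then ρ j (j - 1) else 0 with hB
  set g : ℕ → ℝ := fun j => A j * (φ (j + 1) - φ j) + B j * (φ (j - 1) - φ j) with hg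
  have hrate : ∀ n m : Fin (M + 1), pathRate h W n m = if PathAdj n m then ρ n m else 0 :=
    fun n m => rfl
  have hgen : ∀ n : Fin (M + 1), jumpGen (pathRate h W) f n = g n := by
    intro n
    have h1 : ∀ m : Fin (M + 1), pathRate h W n m * (f m - f n) =
        (if (m : ℕ) = n + 1 then ρ n m * (φ m - φ n) else 0) +
          (if (m : ℕ) = n - 1 then (if 0 < (n : ℕ) then ρ n m * (φ m - φ n) else 0) else 0) := by
      intro m
      rw [hrate, hφf, hφf]
      by_cases h1 : (m : ℕ) = n + 1
      · rw [if_pos (show PathAdj n m from Or.inl h1), if_pos h1, if_neg (by omega), add_zero]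
      · by_cases h2 : (n : ℕ) = m + 1
        · rw [if_pos (show PathAdj n m from Or.inr h2), if_neg h1,
            if_pos (by omega : (m : ℕ) = n - 1), if_pos (by omega : 0 < (n : ℕ)), zero_add]
        · have h3 : ¬ ((m : ℕ) = n - 1 ∧ 0 < (n : ℕ)) := by omega
          rw [if_neg (show ¬ PathAdj n m from not_or.2 ⟨h1, h2⟩), if_neg h1, zero_mul, zero_add,
            ← ite_and, if_neg h3]
    unfold jumpGen
    rw [Finset.sum_congr rfl fun m _ => h1 m, Finset.sum_add_distrib,
      Fin.sum_univ_eq_sum_range (fun m => if m = (n : ℕ) + 1 then ρ n m * (φ m - φ n) else 0),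
      Fin.sum_univ_eq_sum_range (fun m => if m = (n : ℕ) - 1 then
        (if 0 < (n : ℕ) then ρ n m * (φ m - φ n) else 0) else 0),
      Finset.sum_ite_eq', Finset.sum_ite_eq', if_pos (Finset.mem_range.2 (by omega :
        (n : ℕ) - 1 < M + 1))]
    simp only [hg, hA, hB, Finset.mem_range, Nat.add_lt_add_iff_right, ite_mul, zero_mul]
  have hrev : ∀ n m, μ n * ρ n m = μ m * ρ m n := by
    intro n m
    simp only [hμ, hρ]
    rw [mul_div_assoc', mul_div_assoc', mul_assoc, mul_assoc, ← Real.exp_add, ← Real.exp_add]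
    have : -W n + (W n - W m) / 2 = -W m + (W m - W n) / 2 := by ring
    rw [this]
  have hpath : ∀ H : ℕ → ℕ → ℝ, (∀ n m, H n m = H m n) →
      ∑ n : Fin (M + 1), ∑ m : Fin (M + 1), μ n * pathRate h W n m * H n m =
        2 * ∑ j ∈ Finset.range M, μ j * A j * H j (j + 1) := by
    intro H hH
    have h1 : ∀ n m : Fin (M + 1), μ n * pathRate h W n m * H n m =
        if PathAdj n m then (fun n m : ℕ => μ n * ρ n m * H n m) n m else 0 := by
      intro n m
      rw [hrate]
      split_ifs <;> simp
    rw [Finset.sum_congr rfl fun n _ => Finset.sum_congr rfl fun m _ => h1 n m,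
      sum_pathAdj (fun n m : ℕ => μ n * ρ n m * H n m),
      Finset.mul_sum]
    refine Finset.sum_congr rfl fun j hj => ?_
    simp only [hA, if_pos (Finset.mem_range.1 hj)]
    rw [hrev (j + 1) j, hH (j + 1) j]
    ring
  have hconst : -(2 * discreteRate lam h) =
      -(4 * (1 / h ^ 2) * (1 - Real.exp (-(h ^ 2 * lam / 2)))) := by
    unfold discreteRate; ring
  have hε : 0 ≤ 1 - Real.exp (-(h ^ 2 * lam / 2)) := by
    rw [sub_nonneg, Real.exp_le_one_iff]
    have : 0 ≤ h ^ 2 * lam / 2 := by positivity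
    linarith
  have hcontr : ∀ x y : ℝ, h ^ 2 * lam ≤ 2 * (y - x) →
      (1 - Real.exp (-(h ^ 2 * lam / 2))) * (Real.exp y / h ^ 2) ≤
        Real.exp y / h ^ 2 - Real.exp x / h ^ 2 := by
    intro x y hxy
    have : Real.exp x ≤ Real.exp (-(h ^ 2 * lam / 2)) * Real.exp y := by
      rw [← Real.exp_add]
      exact Real.exp_le_exp.2 (by linarith)
    have := div_le_div_of_nonneg_right this (by positivity : 0 ≤ h ^ 2)
    rw [mul_div_assoc] at this
    linarith
  have hmain := birthDeath_decay (M := M) (A := A) (B := B) (μ := μ) (φ := φ)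
    (ε := 1 - Real.exp (-(h ^ 2 * lam / 2))) (κ := 1 / h ^ 2) hφ
    (fun j => by simp only [hμ]; positivity)
    (fun j => by simp only [hA]; split_ifs; exacts [(hρpos _ _).le, le_rfl])
    (fun j => by simp only [hB]; split_ifs; exacts [(hρpos _ _).le, le_rfl])
    (by simp [hA]) (by simp [hB])
    (fun j hj => by simp only [hA, hB, if_pos hj, if_pos (Nat.succ_pos j)]; exact hrev _ _)
    hε (by positivity)
    (fun j hj => by
      simp only [hA, hB, if_pos hj, if_pos (Nat.succ_pos j), hρ, Nat.add_sub_cancel]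
      rw [div_mul_div_comm, ← Real.exp_add]
      have : (W j - W (j + 1)) / 2 + (W (j + 1) - W j) / 2 = 0 := by ring
      rw [this, Real.exp_zero]
      ring)
    (fun j hj => by
      simp only [hA, if_pos hj]
      by_cases hj' : j + 1 < M
      · rw [if_pos hj']
        exact hcontr _ _ (by linarith [hW j (by omega)])
      -- At the end of the path the next rate is zero, and ε ≤ 1 suffices.
      · rw [if_neg hj', sub_zero]
        have := (hρpos j (j + 1)).le
        have := Real.exp_pos (-(h ^ 2 * lam / 2))
        nlinarith)
    (fun j hj => by
      simp only [hB, if_pos (Nat.succ_pos j), Nat.add_sub_cancel]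
      rcases Nat.eq_zero_or_pos j with rfl | hj'
      · rw [if_neg (lt_irrefl 0), sub_zero]
        have := (hρpos (0 + 1) 0).le
        have := Real.exp_pos (-(h ^ 2 * lam / 2))
        nlinarith
      · rw [if_pos hj']
        obtain ⟨i, rfl⟩ : ∃ i, j = i + 1 := ⟨j - 1, by omega⟩
        rw [Nat.add_sub_cancel]
        exact hcontr _ _ (by linarith [hW i (by omega)]))
  have e1 := hpath (fun n m => logGapDeriv (φ n) (φ m) (g n) (g m))
    (fun n m => logGapDeriv_comm _ _ _ _)
  have e2 := hpath (fun n m => logGap (φ n) (φ m)) (fun n m => logGap_comm _ _)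
  simp only [hgen, hφf]
  rw [hconst]
  change ∑ n : Fin (M + 1), ∑ m : Fin (M + 1), μ n * pathRate h W n m *
    (fun n m => logGapDeriv (φ n) (φ m) (g n) (g m)) n m ≤ _ * ∑ n : Fin (M + 1),
    ∑ m : Fin (M + 1), μ n * pathRate h W n m * (fun n m => logGap (φ n) (φ m)) n m
  rw [e1, e2]
  have := mul_le_mul_of_nonneg_left hmain (by norm_num : (0 : ℝ) ≤ 2)
  simp only [hg, Nat.add_sub_cancel]
  linarith

/-! ### Calculus of the logarithmic mean -/

/-- Since Λ(a,b) = b(eᵗ − 1)/t with t = log a − log b, smoothness of Λ across the diagonal reduces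
to the removable singularity at t = 0, settled by the power series. -/
theorem differentiable_dslope_exp : Differentiable ℝ (dslope Real.exp 0) := by
  intro t
  by_cases h : t = 0
  · subst h
    obtain ⟨p, hp⟩ := (analyticAt_rexp : AnalyticAt ℝ Real.exp 0)
    exact hp.has_fpower_series_dslope_fslope.differentiableAt
  · exact (differentiableAt_dslope_of_ne h).2 Real.differentiableAt_exp

theorem logMean_eq_dslope {a b : ℝ} (ha : 0 < a) (hb : 0 < b) :
    logMean a b = b * dslope Real.exp 0 (Real.log a - Real.log b) := by
  unfold logMean
  split_ifs with h
  · subst h; simp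
  · have hne : Real.log a - Real.log b ≠ 0 :=
      sub_ne_zero.2 fun e => h (Real.log_injOn_pos ha hb e)
    rw [dslope_of_ne _ hne, slope_def_field, Real.exp_sub, Real.exp_log ha, Real.exp_log hb,
      Real.exp_zero, sub_zero]
    field_simp

theorem logMean_mul_log_sub {a b : ℝ} (ha : 0 < a) (hb : 0 < b) :
    logMean a b * (Real.log a - Real.log b) = a - b := by
  unfold logMean
  split_ifs with h
  · subst h; simp
  · exact div_mul_cancel₀ _ (sub_ne_zero.2 fun e => h (Real.log_injOn_pos ha hb e))

theorem DifferentiableAt.logMean {E : Type*} [NormedAddCommGroup E] [NormedSpace ℝ E]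
    {a b : E → ℝ} {x : E} (ha : DifferentiableAt ℝ a x) (hb : DifferentiableAt ℝ b x)
    (hax : 0 < a x) (hbx : 0 < b x) :
    DifferentiableAt ℝ (fun z => DiscreteFP.logMean (a z) (b z)) x := by
  have hev : (fun z => DiscreteFP.logMean (a z) (b z)) =ᶠ[nhds x]
      fun z => b z * dslope Real.exp 0 (Real.log (a z) - Real.log (b z)) := by
    filter_upwards [ha.continuousAt.eventually (lt_mem_nhds hax),
      hb.continuousAt.eventually (lt_mem_nhds hbx)] with z h1 h2
    exact logMean_eq_dslope h1 h2
  refine DifferentiableAt.congr_of_eventuallyEq ?_ hev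
  refine hb.mul ?_
  exact DifferentiableAt.comp x (differentiable_dslope_exp _)
    ((ha.log hax.ne').sub (hb.log hbx.ne'))

/-- The logarithmic mean differentiated along a curve. -/
theorem deriv_logMean_mul_sq {a b : ℝ → ℝ} {a' b' t : ℝ} (ha : HasDerivAt a a' t)
    (hb : HasDerivAt b b' t) (hat : 0 < a t) (hbt : 0 < b t) :
    deriv (fun s => logMean (a s) (b s)) t * (Real.log (a t) - Real.log (b t)) ^ 2 =
      (Real.log (a t) - Real.log (b t)) * (a' - b') - (a t - b t) * (a' / a t - b' / b t) := by
  have hΛ := (DifferentiableAt.logMean ha.differentiableAt hb.differentiableAt hat hbt).hasDerivAt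
  -- Differentiate Λ(a,b)(log a − log b) = a − b instead of a quotient: this needs no case a = b.
  have h1 := hΛ.mul ((ha.log hat.ne').sub (hb.log hbt.ne'))
  have h2 : HasDerivAt (fun s => a s - b s) _ t := h1.congr_of_eventuallyEq (by
    filter_upwards [ha.continuousAt.eventually (lt_mem_nhds hat),
      hb.continuousAt.eventually (lt_mem_nhds hbt)] with s h1 h2
    exact (logMean_mul_log_sub h1 h2).symm)
  have h3 := h2.unique (ha.sub hb)
  have h4 := logMean_mul_log_sub hat hbt
  simp only [Pi.sub_apply] at h3
  linear_combination (Real.log (a t) - Real.log (b t)) * h3 - (a' / a t - b' / b t) * h4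

/-! ### Gradient structure and Hessian form -/

section Calculus

variable {d N : ℕ}

theorem mesh_pos (hN : 0 < N) : 0 < mesh N := by
  unfold mesh
  positivity

theorem eventually_pos {U : Lattice d N → ℝ} (hU : ∀ j, 0 < U j) :
    ∀ᶠ W in nhds U, ∀ j, 0 < W j :=
  Filter.eventually_all.2 fun j => (continuous_apply j).continuousAt.eventually (lt_mem_nhds (hU j))

theorem hasDerivAt_line (U Ξ : Lattice d N → ℝ) (j : Lattice d N) (c : ℝ) :
    HasDerivAt (fun t : ℝ => (U + t • Ξ) j / c) (Ξ j / c) 0 := by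
  simpa using (((hasDerivAt_id (0 : ℝ)).mul_const (Ξ j)).const_add (U j)).div_const c

theorem differentiableAt_entropy {π U : Lattice d N → ℝ} (hπ : ∀ j, 0 < π j)
    (hU : ∀ j, 0 < U j) : DifferentiableAt ℝ (entropy π) U := by
  unfold entropy
  refine DifferentiableAt.const_mul (DifferentiableAt.fun_sum fun j _ => ?_) _
  have hj : DifferentiableAt ℝ (fun W : Lattice d N → ℝ => W j) U := differentiableAt_apply j U
  have hj' : DifferentiableAt ℝ (fun W : Lattice d N → ℝ => W j / π j) U := by
    simpa only [div_eq_mul_inv] using hj.mul_const (π j)⁻¹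
  exact hj.mul (hj'.log (div_pos (hU j) (hπ j)).ne')

theorem lineDeriv_entropy {π U : Lattice d N → ℝ} (hπ : ∀ j, 0 < π j) (hU : ∀ j, 0 < U j)
    (Ξ : Lattice d N → ℝ) :
    lineDeriv ℝ (entropy π) U Ξ = mesh N ^ d * ∑ j, Ξ j * (Real.log (U j / π j) + 1) := by
  refine HasLineDerivAt.lineDeriv ?_
  unfold HasLineDerivAt entropy
  refine HasDerivAt.const_mul _ (HasDerivAt.fun_sum fun j _ => ?_)
  have h1 := hasDerivAt_line U Ξ j (π j)
  have h2 := hasDerivAt_line U Ξ j 1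
  simp only [div_one] at h2
  have hne : (U + (0 : ℝ) • Ξ) j / π j ≠ 0 := by simpa using (div_pos (hU j) (hπ j)).ne'
  refine (h2.mul (h1.log hne)).congr_deriv ?_
  have := (hπ j).ne'
  have := (hU j).ne'
  simp only [zero_smul, add_zero]
  field_simp

/-- The zero-mean normalization and the constant from differentiating the logarithm are the same at
all sites. The Onsager operator sees only differences. -/
theorem differential_entropy_sub (hN : 0 < N) {π U : Lattice d N → ℝ} (hπ : ∀ j, 0 < π j)
    (hU : ∀ j, 0 < U j) (i l : Lattice d N) :
    differential (entropy π) U i - differential (entropy π) U l =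
      Real.log (U i / π i) - Real.log (U l / π l) := by
  have hm : mesh N ^ d ≠ 0 := (pow_pos (mesh_pos hN) d).ne'
  unfold differential
  simp only [lineDeriv_entropy hπ hU, mul_div_cancel_left₀ _ hm, Pi.sub_apply, sub_mul,
    Finset.sum_sub_distrib, Pi.single_apply, ite_mul, one_mul, zero_mul]
  simp

/-- The symmetric edge weights of the finite-volume scheme. -/
def edgeWeight (π : Lattice d N → ℝ) (i j : Lattice d N) : ℝ :=
  if Nbr i j then Real.sqrt (π i * π j) / mesh N ^ 2 else 0

theorem edgeWeight_comm (π : Lattice d N → ℝ) (i j : Lattice d N) :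
    edgeWeight π i j = edgeWeight π j i := by
  unfold edgeWeight
  by_cases h : Nbr i j
  · rw [if_pos h, if_pos h.symm, mul_comm]
  · rw [if_neg h, if_neg fun h' => h h'.symm]

theorem not_nbr_self (i : Lattice d N) : ¬ Nbr i i := by simp [Nbr]

theorem onsager_eq (π U Q : Lattice d N → ℝ) (i : Lattice d N) :
    onsager π U Q i =
      ∑ j, edgeWeight π i j * logMean (U i / π i) (U j / π j) * (Q i - Q j) := by
  unfold onsager edgeWeight
  refine Finset.sum_congr rfl fun j _ => ?_
  split_ifs <;> ring

/-- As √(π i / π j) = √(π i π j) / π j, the matrix acts on U/π as a symmetric weighted graph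
Laplacian. -/
theorem fokkerPlanck_mulVec {π : Lattice d N → ℝ} (hπ : ∀ j, 0 < π j) (U : Lattice d N → ℝ)
    (i : Lattice d N) :
    (fokkerPlanck π).mulVec U i = ∑ j, edgeWeight π i j * (U j / π j - U i / π i) := by
  have hsqrt : ∀ i j, Real.sqrt (π i / π j) = Real.sqrt (π i * π j) / π j := by
    intro i j
    have : π i / π j = π i * π j / π j ^ 2 := by
      have := (hπ j).ne'
      field_simp
    rw [this, Real.sqrt_div (mul_pos (hπ i) (hπ j)).le, Real.sqrt_sq (hπ j).le]
  have hentry : ∀ j, fokkerPlanck π i j * U j = edgeWeight π i j * (U j / π j) -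
      if i = j then ∑ l, edgeWeight π i l * (U i / π i) else 0 := by
    intro j
    unfold fokkerPlanck
    by_cases h : Nbr i j
    · have hne : i ≠ j := fun e => not_nbr_self j (e ▸ h)
      rw [if_pos h, if_neg hne, hsqrt, edgeWeight, if_pos h]
      ring
    · rw [if_neg h]
      by_cases hij : i = j
      · subst hij
        rw [if_pos rfl, if_pos rfl, edgeWeight, if_neg h, zero_mul, zero_sub, neg_mul,
          Finset.sum_div, Finset.sum_mul]
        congr 1
        refine Finset.sum_congr rfl fun l _ => ?_
        rw [edgeWeight_comm, edgeWeight, hsqrt]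
        split_ifs <;> ring
      · rw [if_neg hij, if_neg hij, edgeWeight, if_neg h]
        ring
  rw [Matrix.mulVec, dotProduct, Finset.sum_congr rfl fun j _ => hentry j,
    Finset.sum_sub_distrib, Finset.sum_ite_eq, if_pos (Finset.mem_univ i),
    ← Finset.sum_sub_distrib]
  exact Finset.sum_congr rfl fun j _ => by ring

theorem gradFlow_entropy (hN : 0 < N) {π U : Lattice d N → ℝ} (hπ : ∀ j, 0 < π j)
    (hU : ∀ j, 0 < U j) :
    gradFlow (onsager π) (entropy π) U = (fokkerPlanck π).mulVec U := by
  ext i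
  rw [fokkerPlanck_mulVec hπ]
  unfold gradFlow
  rw [Pi.neg_apply, onsager_eq, ← Finset.sum_neg_distrib]
  refine Finset.sum_congr rfl fun j _ => ?_
  rw [differential_entropy_sub hN hπ hU, mul_assoc,
    logMean_mul_log_sub (div_pos (hU i) (hπ i)) (div_pos (hU j) (hπ j))]
  ring

/-- Positivity is an open condition and the total mass plays no role, so the vector field is linear
on a full neighbourhood and its derivative is the matrix. -/
theorem gradFlow_entropy_eventuallyEq (hN : 0 < N) {π U : Lattice d N → ℝ} (hπ : ∀ j, 0 < π j)
    (hU : ∀ j, 0 < U j) :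
    gradFlow (onsager π) (entropy π) =ᶠ[nhds U]
      (LinearMap.toContinuousLinearMap (fokkerPlanck π).mulVecLin) := by
  filter_upwards [eventually_pos hU] with W hW
  simpa using gradFlow_entropy hN hπ hW

theorem differentiableAt_gradFlow_entropy (hN : 0 < N) {π U : Lattice d N → ℝ}
    (hπ : ∀ j, 0 < π j) (hU : ∀ j, 0 < U j) :
    DifferentiableAt ℝ (gradFlow (onsager π) (entropy π)) U :=
  (ContinuousLinearMap.differentiableAt _).congr_of_eventuallyEq
    (gradFlow_entropy_eventuallyEq hN hπ hU)

theorem lineDeriv_gradFlow_entropy (hN : 0 < N) {π U : Lattice d N → ℝ} (hπ : ∀ j, 0 < π j)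
    (hU : ∀ j, 0 < U j) (Ξ : Lattice d N → ℝ) :
    lineDeriv ℝ (gradFlow (onsager π) (entropy π)) U Ξ = (fokkerPlanck π).mulVec Ξ := by
  rw [(gradFlow_entropy_eventuallyEq hN hπ hU).lineDeriv_eq,
    (ContinuousLinearMap.differentiableAt _).lineDeriv_eq_fderiv, ContinuousLinearMap.fderiv]
  simp

theorem differentiableAt_onsager {π U : Lattice d N → ℝ} (hπ : ∀ j, 0 < π j)
    (hU : ∀ j, 0 < U j) (P : Lattice d N → ℝ) :
    DifferentiableAt ℝ (fun W => onsager π W P) U := by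
  refine differentiableAt_pi.2 fun i => ?_
  simp only [onsager_eq]
  refine DifferentiableAt.fun_sum fun j _ => DifferentiableAt.mul_const (.const_mul ?_ _) _
  have h : ∀ l, DifferentiableAt ℝ (fun W : Lattice d N → ℝ => W l / π l) U := by
    intro l
    have hl : DifferentiableAt ℝ (fun W : Lattice d N → ℝ => W l) U := differentiableAt_apply l U
    simpa only [div_eq_mul_inv] using hl.mul_const (π l)⁻¹
  exact DifferentiableAt.logMean (h i) (h j) (div_pos (hU i) (hπ i)) (div_pos (hU j) (hπ j))

theorem lineDeriv_onsager {π U : Lattice d N → ℝ} (hπ : ∀ j, 0 < π j)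
    (hU : ∀ j, 0 < U j) (P Ξ : Lattice d N → ℝ) (i : Lattice d N) :
    lineDeriv ℝ (fun W => onsager π W P) U Ξ i = ∑ j, edgeWeight π i j *
      deriv (fun t : ℝ => logMean ((U + t • Ξ) i / π i) ((U + t • Ξ) j / π j)) 0 * (P i - P j) := by
  have h : HasLineDerivAt ℝ (fun W => onsager π W P) (fun i => ∑ j, edgeWeight π i j *
      deriv (fun t : ℝ => logMean ((U + t • Ξ) i / π i) ((U + t • Ξ) j / π j)) 0 *
        (P i - P j)) U Ξ := by
    unfold HasLineDerivAt
    refine hasDerivAt_pi.2 fun i => ?_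
    simp only [onsager_eq]
    refine HasDerivAt.fun_sum fun j _ => HasDerivAt.mul_const (HasDerivAt.const_mul _ ?_) _
    refine (DifferentiableAt.logMean (hasDerivAt_line U Ξ i _).differentiableAt
      (hasDerivAt_line U Ξ j _).differentiableAt ?_ ?_).hasDerivAt
    · simpa using div_pos (hU i) (hπ i)
    · simpa using div_pos (hU j) (hπ j)
  rw [h.lineDeriv]

/-- Summation by parts on a weighted graph. -/
theorem pairing_sum_antisymm (P : Lattice d N → ℝ) {A : Lattice d N → Lattice d N → ℝ}
    (hA : ∀ i j, A j i = -A i j) :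
    pairing P (fun i => ∑ j, A i j) = mesh N ^ d * (1 / 2 * ∑ i, ∑ j, (P i - P j) * A i j) := by
  unfold pairing
  congr 1
  have h1 : ∑ i, ∑ j, P j * A i j = -∑ i, ∑ j, P i * A i j := by
    rw [Finset.sum_comm, ← Finset.sum_neg_distrib]
    refine Finset.sum_congr rfl fun i _ => ?_
    rw [← Finset.sum_neg_distrib]
    exact Finset.sum_congr rfl fun j _ => by rw [hA]; ring
  simp only [sub_mul, Finset.sum_sub_distrib]
  rw [h1, Finset.sum_congr rfl fun i _ => Finset.mul_sum _ (A i) (P i)]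
  ring

/-- The entropy production as a sum over edges. -/
theorem pairing_differential_onsager (hN : 0 < N) {π U : Lattice d N → ℝ} (hπ : ∀ j, 0 < π j)
    (hU : ∀ j, 0 < U j) :
    pairing (differential (entropy π) U) (onsager π U (differential (entropy π) U)) =
      mesh N ^ d * (1 / 2 * ∑ i, ∑ j, edgeWeight π i j * logGap (U i / π i) (U j / π j)) := by
  rw [funext fun i => onsager_eq π U (differential (entropy π) U) i, pairing_sum_antisymm]
  · congr 2
    refine Finset.sum_congr rfl fun i _ => Finset.sum_congr rfl fun j _ => ?_
    rw [differential_entropy_sub hN hπ hU, mul_assoc,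
      logMean_mul_log_sub (div_pos (hU i) (hπ i)) (div_pos (hU j) (hπ j)), logGap]
    ring
  · intro i j
    rw [edgeWeight_comm, logMean_comm]
    ring

/-- The Hessian form along the gradient flow as a sum over edges. -/
theorem hessForm_entropy (hN : 0 < N) {π U : Lattice d N → ℝ} (hπ : ∀ j, 0 < π j)
    (hU : ∀ j, 0 < U j) :
    hessForm (onsager π) (entropy π) U (differential (entropy π) U) =
      -(mesh N ^ d * (1 / 4 * ∑ i, ∑ j, edgeWeight π i j *
        logGapDeriv (U i / π i) (U j / π j) ((fokkerPlanck π).mulVec U i / π i)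
          ((fokkerPlanck π).mulVec U j / π j))) := by
  set P := differential (entropy π) U with hP
  set F := (fokkerPlanck π).mulVec U with hF
  have hPsub : ∀ i j, P i - P j = Real.log (U i / π i) - Real.log (U j / π j) :=
    differential_entropy_sub hN hπ hU
  have hK : onsager π U P = -F := by
    rw [hF, ← gradFlow_entropy hN hπ hU, gradFlow, neg_neg]
  have h1 : pairing P ((fokkerPlanck π).mulVec (-F)) = mesh N ^ d * (1 / 2 * ∑ i, ∑ j,
      edgeWeight π i j * ((P i - P j) * (F i / π i - F j / π j))) := by
    rw [funext fun i => fokkerPlanck_mulVec hπ (-F) i, pairing_sum_antisymm]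
    · congr 2
      refine Finset.sum_congr rfl fun i _ => Finset.sum_congr rfl fun j _ => ?_
      simp only [Pi.neg_apply]
      ring
    · intro i j
      rw [edgeWeight_comm]
      ring
  have h2 : pairing P (lineDeriv ℝ (fun W => onsager π W P) U F) =
      mesh N ^ d * (1 / 2 * ∑ i, ∑ j, edgeWeight π i j *
        ((P i - P j) * (F i / π i - F j / π j) - (U i / π i - U j / π j) *
          (F i / π i / (U i / π i) - F j / π j / (U j / π j)))) := by
    rw [funext fun i => lineDeriv_onsager hπ hU P F i, pairing_sum_antisymm]
    · congr 2
      refine Finset.sum_congr rfl fun i _ => Finset.sum_congr rfl fun j _ => ?_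
      have := deriv_logMean_mul_sq (hasDerivAt_line U F i (π i)) (hasDerivAt_line U F j (π j))
        (by simpa using div_pos (hU i) (hπ i)) (by simpa using div_pos (hU j) (hπ j))
      simp only [zero_smul, add_zero] at this
      rw [hPsub, ← this]
      ring
    · intro i j
      rw [edgeWeight_comm]
      have : (fun t : ℝ => logMean ((U + t • F) j / π j) ((U + t • F) i / π i)) =
        fun t : ℝ => logMean ((U + t • F) i / π i) ((U + t • F) j / π j) :=
        funext fun t => logMean_comm _ _
      rw [this]
      ring
  unfold hessForm
  rw [hK, lineDeriv_gradFlow_entropy hN hπ hU, gradFlow_entropy hN hπ hU, h1, h2]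
  -- With A the sum from `h1` and B = A − R the one from `h2`, 2A − B = A + R is the derivative of
  -- the θ-sum.
  have h4 : ∀ m A B C : ℝ, 2 * A - B = C →
      -(m * (1 / 2 * A)) + 1 / 2 * (m * (1 / 2 * B)) = -(m * (1 / 4 * C)) := by
    rintro m A B C rfl; ring
  refine h4 _ _ _ _ ?_
  rw [Finset.mul_sum, ← Finset.sum_sub_distrib]
  refine Finset.sum_congr rfl fun i _ => ?_
  rw [Finset.mul_sum, ← Finset.sum_sub_distrib]
  refine Finset.sum_congr rfl fun j _ => ?_
  rw [hPsub, logGapDeriv]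
  ring

end Calculus

/-! ### The lattice as a product of paths -/

section Product

variable {d N : ℕ}

open Function

theorem nbr_update {i : Lattice d N} {k : Fin d} {m : Fin N} (h : PathAdj (i k) m) :
    Nbr i (update i k m) := by
  unfold Nbr
  rw [Finset.sum_eq_single k]
  · rw [update_self]
    rcases h with h | h <;> rw [h] <;> push_cast <;> ring
  · intro l _ hl
    rw [update_of_ne hl]
    ring
  · simp

/-- Integer squares with sum 1 have exactly one nonzero term, and its root is ±1. -/
theorem Nbr.exists_update {i j : Lattice d N} (h : Nbr i j) :
    ∃ k, PathAdj (i k) (j k) ∧ update i k (j k) = j := by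
  unfold Nbr at h
  obtain ⟨k, hk⟩ : ∃ k, ((i k : ℕ) : ℤ) - ((j k : ℕ) : ℤ) ≠ 0 := by
    by_contra! hall
    simp [hall] at h
  have hk1 : 1 ≤ (((i k : ℕ) : ℤ) - ((j k : ℕ) : ℤ)) ^ 2 := Int.add_one_le_iff.2 (sq_pos_of_ne_zero hk)
  rw [← Finset.add_sum_erase _ _ (Finset.mem_univ k)] at h
  have hnn : ∀ l ∈ Finset.univ.erase k, 0 ≤ (((i l : ℕ) : ℤ) - ((j l : ℕ) : ℤ)) ^ 2 :=
    fun l _ => sq_nonneg _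
  have hrest := Finset.sum_nonneg hnn
  have hzero : ∑ l ∈ Finset.univ.erase k, (((i l : ℕ) : ℤ) - ((j l : ℕ) : ℤ)) ^ 2 = 0 := by
    linarith
  refine ⟨k, ?_, ?_⟩
  · have h1 : (((i k : ℕ) : ℤ) - ((j k : ℕ) : ℤ)) ^ 2 = 1 := by linarith
    unfold PathAdj
    rcases mul_self_eq_one_iff.1 ((sq _).symm.trans h1) with h2 | h2 <;> omega
  · ext l
    by_cases hl : l = k
    · subst hl; simp
    · have := (Finset.sum_eq_zero_iff_of_nonneg hnn).1 hzero l
        (Finset.mem_erase.2 ⟨hl, Finset.mem_univ l⟩)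
      have := pow_eq_zero_iff two_ne_zero |>.1 this
      rw [update_of_ne hl]
      omega

theorem sum_nbr (i : Lattice d N) (F : Lattice d N → ℝ) :
    ∑ j, (if Nbr i j then F j else 0) =
      ∑ k, ∑ m, if PathAdj (i k) m then F (update i k m) else 0 := by
  rw [← Fintype.sum_prod_type', ← Finset.sum_filter, ← Finset.sum_filter]
  symm
  have hne : ∀ n m : Fin N, PathAdj n m → m ≠ n := by
    rintro n m h rfl
    unfold PathAdj at h
    omega
  refine Finset.sum_bij (fun p _ => update i p.1 p.2) ?_ ?_ ?_ ?_
  · rintro ⟨k, m⟩ h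
    simpa using nbr_update (by simpa using h)
  · rintro ⟨k, m⟩ h ⟨k', m'⟩ h' e
    have h := hne _ _ (by simpa using h : PathAdj (i k) m)
    simp only at e
    have hkk : k = k' := by
      by_contra hkk
      have := congrFun e k
      rw [update_self, update_of_ne hkk] at this
      exact h this
    subst hkk
    have := congrFun e k
    rw [update_self, update_self] at this
    rw [this]
  · intro j hj
    obtain ⟨k, hk, e⟩ := (by simpa using hj : Nbr i j).exists_update
    exact ⟨(k, j k), by simpa using hk, e⟩
  · intro p _
    rfl

theorem steady₁_pos (hN : 0 < N) (v : ℝ → ℝ) (j : Fin N) : 0 < steady₁ N v j := by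
  have : Nonempty (Fin N) := ⟨⟨0, hN⟩⟩
  exact div_pos (Real.exp_pos _) (mul_pos (mesh_pos hN)
    (Finset.sum_pos (fun _ _ => Real.exp_pos _) Finset.univ_nonempty))

theorem steady_pos (hN : 0 < N) (v : Fin d → ℝ → ℝ) (j : Lattice d N) : 0 < steady N v j :=
  Finset.prod_pos fun _ _ => steady₁_pos hN _ _

/-- The normalizing constants cancel in the ratio, so only differences of cell averages enter the
rates. -/
theorem steady_update (v : Fin d → ℝ → ℝ) (i : Lattice d N) (k : Fin d) (m : Fin N) :
    steady N v (update i k m) = steady N v i *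
      Real.exp (cellMean (mesh N) (v k) (i k) - cellMean (mesh N) (v k) m) := by
  have h1 : steady₁ N (v k) m = steady₁ N (v k) (i k) *
      Real.exp (cellMean (mesh N) (v k) (i k) - cellMean (mesh N) (v k) m) := by
    have e : ∀ n : Fin N, cellAverage N (v k) n = cellMean (mesh N) (v k) n := fun n => rfl
    unfold steady₁
    rw [div_mul_eq_mul_div, ← Real.exp_add, e m, e (i k)]
    congr 2
    ring
  unfold steady
  rw [← Finset.mul_prod_erase _ _ (Finset.mem_univ k),
    ← Finset.mul_prod_erase _ (fun l => steady₁ N (v l) (i l)) (Finset.mem_univ k), update_self, h1]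
  have h2 : ∏ l ∈ Finset.univ.erase k, steady₁ N (v l) (update i k m l) =
      ∏ l ∈ Finset.univ.erase k, steady₁ N (v l) (i l) :=
    Finset.prod_congr rfl fun l hl => by rw [update_of_ne (Finset.ne_of_mem_erase hl)]
  rw [h2]
  ring

theorem sum_edgeWeight_steady (hN : 0 < N) (v : Fin d → ℝ → ℝ) (i : Lattice d N)
    (F : Lattice d N → ℝ) :
    ∑ j, edgeWeight (steady N v) i j * F j = ∑ k, ∑ m, steady N v i *
      pathRate (mesh N) (cellMean (mesh N) (v k)) (i k) m * F (update i k m) := by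
  have h1 : ∀ j, edgeWeight (steady N v) i j * F j = if Nbr i j then
      Real.sqrt (steady N v i * steady N v j) / mesh N ^ 2 * F j else 0 := by
    intro j
    unfold edgeWeight
    split_ifs <;> ring
  rw [Finset.sum_congr rfl fun j _ => h1 j, sum_nbr]
  refine Finset.sum_congr rfl fun k _ => Finset.sum_congr rfl fun m _ => ?_
  unfold pathRate
  split_ifs
  · have hsq : steady N v i * steady N v (update i k m) = (steady N v i * Real.exp
        ((cellMean (mesh N) (v k) (i k) - cellMean (mesh N) (v k) m) / 2)) ^ 2 := by
      rw [steady_update, mul_pow, ← Real.exp_nat_mul]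
      push_cast
      rw [mul_div_cancel₀ _ (two_ne_zero)]
      ring
    rw [hsq, Real.sqrt_sq (mul_pos (steady_pos hN v i) (Real.exp_pos _)).le]
    ring
  · ring

theorem convexDecay_steady (hN : 0 < N) {lam : ℝ} (hlam : 0 ≤ lam) {v : Fin d → ℝ → ℝ}
    (hv : ∀ k, StrongConvexOn (Set.Icc 0 1) lam (v k)) :
    ConvexDecay (onsager (steady N v)) (entropy (steady N v)) (discreteRate lam (mesh N)) := by
  rintro U ⟨hU, -⟩
  have : Nonempty (Fin N) := ⟨⟨0, hN⟩⟩
  set π := steady N v with hπ_def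
  have hπ : ∀ j, 0 < π j := steady_pos hN v
  have hmesh := mesh_pos hN
  have hmain := production_decay_product (π := π)
    (r := fun k => pathRate (mesh N) (cellMean (mesh N) (v k)))
    -- The factor 2 reflects that the Hessian form is −½ times the derivative of the production.
    (c := 2 * discreteRate lam (mesh N)) (f := fun i => U i / π i)
    (g := fun i => (fokkerPlanck π).mulVec U i / π i)
    (fun i => (hπ i).le) (fun k n m => pathRate_nonneg _ _ _ _)
    (fun i k m => by
      rw [hπ_def, steady_update]
      simp only [pathRate]
      by_cases h : PathAdj (i k) m
      · rw [if_pos h, if_pos (show PathAdj m (i k) from Or.symm h), mul_assoc,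
          mul_div_assoc' (Real.exp _), ← Real.exp_add]
        congr 3
        ring
      · rw [if_neg h, if_neg (show ¬ PathAdj m (i k) from fun h' => h (Or.symm h')), mul_zero, mul_zero])
    (fun i k => by
      have h := pathRate_decay (N := N) (C := π i * Real.exp (cellMean (mesh N) (v k) (i k)))
        (W := cellMean (mesh N) (v k)) hmesh hlam (mul_pos (hπ i) (Real.exp_pos _)).le hN
        (fun j hj => cellMean_second_difference hmesh (hv k) hlam (by
          have h1 : ((j : ℝ) + 3) ≤ N := by exact_mod_cast hj
          have h2 : (0 : ℝ) < N := by exact_mod_cast hN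
          rw [mesh, one_div, inv_mul_le_iff₀ h2]
          linarith))
      have e : (fun n => π (update i k n)) = fun n : Fin N =>
          π i * Real.exp (cellMean (mesh N) (v k) (i k)) *
            Real.exp (-cellMean (mesh N) (v k) n) := by
        funext n
        rw [hπ_def, steady_update, sub_eq_add_neg, Real.exp_add]
        ring
      rw [e]
      exact h)
    (fun i => div_pos (hU i) (hπ i))
    (fun i => by
      rw [fokkerPlanck_mulVec hπ, sum_edgeWeight_steady hN v i fun j => U j / π j - U i / π i,
        Finset.sum_div]
      refine Finset.sum_congr rfl fun k _ => ?_
      rw [Finset.sum_div]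
      refine Finset.sum_congr rfl fun m _ => ?_
      simp only [update_eq_self]
      rw [mul_assoc]
      exact mul_div_cancel_left₀ _ (hπ i).ne')
  rw [hessForm_entropy hN hπ hU, pairing_differential_onsager hN hπ hU]
  simp only [hπ_def, sum_edgeWeight_steady hN v _ fun j => logGapDeriv _ (U j / steady N v j) _
    ((fokkerPlanck (steady N v)).mulVec U j / steady N v j),
    sum_edgeWeight_steady hN v _ fun j => logGap _ (U j / steady N v j)]
  have := mul_le_mul_of_nonneg_left hmain (by positivity : 0 ≤ mesh N ^ d / 4)
  linarith

end Product

theorem discreteRate_sub_isBigO (lam : ℝ) :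
    Asymptotics.IsBigO (nhdsWithin 0 (Set.Ioi 0)) (fun h : ℝ => discreteRate lam h - lam)
      (fun h : ℝ => h ^ 2) := by
  -- From |eˣ − 1 − x| ≤ x² at x = −h²λ/2: (2/h²)·(h²λ/2)² = (λ²/2)h².
  refine Asymptotics.IsBigO.of_bound (lam ^ 2 / 2) ?_
  have hsmall : ∀ᶠ h : ℝ in nhdsWithin 0 (Set.Ioi 0), |-(h ^ 2 * lam / 2)| < 1 := by
    refine Filter.Eventually.filter_mono nhdsWithin_le_nhds ?_
    have hc : ContinuousAt (fun h : ℝ => |-(h ^ 2 * lam / 2)|) 0 := by fun_prop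
    exact hc.eventually (gt_mem_nhds (by simp))
  filter_upwards [hsmall, self_mem_nhdsWithin] with h hh hpos
  have hpos : 0 < h := hpos
  have h1 := Real.abs_exp_sub_one_sub_id_le hh.le
  have e : discreteRate lam h - lam = -(2 / h ^ 2 *
      (Real.exp (-(h ^ 2 * lam / 2)) - 1 - -(h ^ 2 * lam / 2))) := by
    unfold discreteRate
    field_simp
    ring
  have h2 : 0 < 2 / h ^ 2 := by positivity
  rw [e, Real.norm_eq_abs, abs_neg, abs_mul, abs_of_pos h2, Real.norm_eq_abs,
    abs_of_pos (by positivity : 0 < h ^ 2)]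
  refine (mul_le_mul_of_nonneg_left h1 h2.le).trans (le_of_eq ?_)
  field_simp

end

end DiscreteFP

open DiscreteFP in
theorem proposition3 (d : ℕ) (lam : ℝ) (hlam : 0 < lam)
    (V : EuclideanSpace ℝ (Fin d) → ℝ) (v : Fin d → ℝ → ℝ)
    (hV : StrongConvexOn (unitCube d) lam V)
    (hsep : ∀ x ∈ unitCube d, V x = ∑ k, v k (x k)) :
    (∀ N : ℕ, 0 < N →
      (∀ U ∈ posDensities d N,
        DifferentiableAt ℝ (entropy (steady N v)) U ∧
        DifferentiableAt ℝ (gradFlow (onsager (steady N v)) (entropy (steady N v))) U ∧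
        (∀ P, DifferentiableAt ℝ (fun W => onsager (steady N v) W P) U) ∧
        gradFlow (onsager (steady N v)) (entropy (steady N v)) U =
          (fokkerPlanck (steady N v)).mulVec U) ∧
      ConvexDecay (onsager (steady N v)) (entropy (steady N v)) (discreteRate lam (mesh N))) ∧
    Asymptotics.IsBigO (nhdsWithin 0 (Set.Ioi 0)) (fun h : ℝ => discreteRate lam h - lam)
      (fun h : ℝ => h ^ 2) := by
  refine ⟨fun N hN => ⟨fun U hU => ?_, ?_⟩, discreteRate_sub_isBigO lam⟩
  · have hπ := steady_pos hN v
    exact ⟨differentiableAt_entropy hπ hU.1, differentiableAt_gradFlow_entropy hN hπ hU.1,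
      differentiableAt_onsager hπ hU.1, gradFlow_entropy hN hπ hU.1⟩
  · exact convexDecay_steady hN hlam.le fun k => strongConvexOn_coordinate hV hsep k
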